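/- Write $\mathbb R_+=[0,\infty)$ and let $\mathcal F(\mathbb R_+)$ be the space of closed subsets of $\mathbb R_+$ with the Borel $\sigma$-algebra of the Fell topology. Let $\alpha>0$ and $\beta\in(0,1)$, and let $P_{R^{(\beta)}}$ be the law on $\mathcal F(\mathbb R_+)$ of a $\beta$-stable regenerative set, i.e. of the closure of the range of a strictly $\beta$-stable subordinator (a subordinator with Laplace exponent $c\lambda^\beta$, $c>0$). Let $(U_j,V_j,R_j)_{j\in\mathbb N}$ be a measurable enumeration of the points of a Poisson point process on $\mathbb R_+\times\mathbb R_+\times\mathcal F(\mathbb R_+)$ with mean measure $$\alpha u^{-(1+\alpha)}\,du\;(1-\beta)v^{-\beta}\,dv\;dP_{R^{(\beta)}},$$ and define $$\eta^{\alpha,\beta}(t)=\sum_{j=1}^\infty U_j\mathbf 1_{\{t\in V_j+R_j\}},\quad t\in\mathbb R_+,\qquad \eta^{\alpha,\beta}(G)=\sup_{t\in G}\eta^{\alpha,\beta}(t),\quad G\subset\mathbb R_+\text{ open}.$$ Then $$x^\alpha\,\mathbb P\bigl(\eta^{\alpha,\beta}((0,1))>x\bigr)\to 1\qquad\text{as }x\to\infty.$$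 In particular, the tail of $\eta^{\alpha,\beta}((0,1))$ is regularly varying with index $-\alpha$: for every $c>0$, $\mathbb P(\eta^{\alpha,\beta}((0,1))>cx)/\mathbb P(\eta^{\alpha,\beta}((0,1))>x)\to c^{-\alpha}$ as $x\to\infty$. -/

import Mathlib

open MeasureTheory ProbabilityTheory Filter Set
open scoped NNReal ENNReal Topology

noncomputable section

/-- The space `F(ℝ₊)` of closed subsets of `ℝ₊ = [0, ∞)`. -/
structure ClosedSubset where
  /-- the underlying set -/
  carrier : Set ℝ≥0
  isClosed : IsClosed carrier

namespace ClosedSubset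

/-- The Fell topology, generated by `{F | F ∩ G ≠ ∅}`, `G` open, and `{F | F ∩ K = ∅}`,
`K` compact. -/
instance instTopologicalSpace : TopologicalSpace ClosedSubset :=
  TopologicalSpace.generateFrom
    ({A | ∃ G : Set ℝ≥0, IsOpen G ∧ A = {F | (F.carrier ∩ G).Nonempty}} ∪
      {A | ∃ K : Set ℝ≥0, IsCompact K ∧ A = {F | F.carrier ∩ K = ∅}})

instance instMeasurableSpace : MeasurableSpace ClosedSubset := borel ClosedSubset

instance instBorelSpace : BorelSpace ClosedSubset := ⟨rfl⟩

/-- The closure of the range of a path `f : ℝ₊ → ℝ₊`. -/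
def closureRange (f : ℝ≥0 → ℝ≥0) : ClosedSubset := ⟨closure (range f), isClosed_closure⟩

end ClosedSubset

/-- `σ` is a (strictly) `β`-stable subordinator under `P`: a process started at `0` with
nondecreasing right-continuous paths and stationary independent increments, whose Laplace
exponent is `c * l ^ β` for some constant `c > 0`. -/
structure IsStableSubordinator {Ω : Type*} [MeasurableSpace Ω] (β : ℝ)
    (σ : ℝ≥0 → Ω → ℝ≥0) (P : Measure Ω) : Prop where
  measurable : ∀ t, Measurable (σ t)
  zero : ∀ ω, σ 0 ω = 0
  monotone : ∀ ω, Monotone fun t => σ t ω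
  rightContinuous : ∀ ω t, ContinuousWithinAt (fun s => σ s ω) (Ici t) t
  indepIncrements : HasIndepIncrements σ P
  stationaryIncrements : ∀ s t, IdentDistrib (fun ω => σ (s + t) ω - σ s ω) (σ t) P P
  laplace : ∃ c : ℝ, 0 < c ∧ ∀ t l : ℝ≥0,
    ∫ ω, Real.exp (-((l : ℝ) * (σ t ω : ℝ))) ∂P = Real.exp (-(c * t * (l : ℝ) ^ β))

/-- `ν` is the law on `F(ℝ₊)` of a `β`-stable regenerative set, that is, of the closure of the
range of a `β`-stable subordinator. -/
def IsStableRegenerativeLaw (β : ℝ) (ν : Measure ClosedSubset) : Prop :=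
  ∃ (Ω : Type) (_ : MeasurableSpace Ω) (P : Measure Ω) (σ : ℝ≥0 → Ω → ℝ≥0),
    IsProbabilityMeasure P ∧ IsStableSubordinator β σ P ∧
      HasLaw (fun ω => ClosedSubset.closureRange fun t => σ t ω) ν P

/-- The number of indices `j` with `X j ω ∈ B`. -/
def pointCount {Ω E : Type*} (X : ℕ → Ω → E) (B : Set E) (ω : Ω) : ℕ∞ :=
  {j : ℕ | X j ω ∈ B}.encard

/-- The Poisson distribution with mean `m ∈ [0, ∞]`; for `m = ∞` it is the point mass at `∞`. -/
def poissonLaw (m : ℝ≥0∞) : Measure ℕ∞ :=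
  if m = ∞ then Measure.dirac ⊤ else (poissonMeasure m.toNNReal).map (fun n : ℕ => (n : ℕ∞))

/-- `X 0, X 1, …` is a measurable enumeration of the points of a Poisson point process on `E`
with mean measure `μ`. -/
structure IsPoissonEnumeration {Ω E : Type*} [MeasurableSpace Ω] [MeasurableSpace E]
    (X : ℕ → Ω → E) (μ : Measure E) (P : Measure Ω) : Prop where
  measurable : ∀ j, Measurable (X j)
  hasLaw : ∀ B : Set E, MeasurableSet B → HasLaw (pointCount X B) (poissonLaw (μ B)) P
  indep : ∀ (n : ℕ) (B : Fin n → Set E), (∀ i, MeasurableSet (B i)) →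
    Pairwise (Function.onFun Disjoint B) → iIndepFun (fun i => pointCount X (B i)) P

/-- Lebesgue measure on `ℝ₊`. -/
def lebesguePos : Measure ℝ≥0 := ((volume : Measure ℝ).restrict (Ici 0)).map Real.toNNReal

/-- The measure `α u^{-(1+α)} du ⊗ (1-β) v^{-β} dv ⊗ ν` on `ℝ₊ × ℝ₊ × F(ℝ₊)`. -/
def meanMeasure (α β : ℝ) (ν : Measure ClosedSubset) : Measure (ℝ≥0 × ℝ≥0 × ClosedSubset) :=
  (lebesguePos.withDensity
      fun u => ENNReal.ofReal (α * (u : ℝ) ^ (-(1 + α)))).prod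
    ((lebesguePos.withDensity
      fun v => ENNReal.ofReal ((1 - β) * (v : ℝ) ^ (-β))).prod ν)

/-- The shifted set `v + F`. -/
def shiftedSet (v : ℝ≥0) (F : ClosedSubset) : Set ℝ≥0 := (fun r => v + r) '' F.carrier

/-- The function `η(t) = ∑_j U_j 1{t ∈ V_j + R_j}` attached to points `(U_j, V_j, R_j)`. -/
def etaFun (p : ℕ → ℝ≥0 × ℝ≥0 × ClosedSubset) (t : ℝ≥0) : ℝ≥0∞ :=
  ∑' j, (shiftedSet (p j).2.1 (p j).2.2).indicator (fun _ => ((p j).1 : ℝ≥0∞)) t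

/-- The corresponding sup-measure `η(G) = sup_{t ∈ G} η(t)`. -/
def etaSup (p : ℕ → ℝ≥0 × ℝ≥0 × ClosedSubset) (G : Set ℝ≥0) : ℝ≥0∞ :=
  ⨆ t ∈ G, etaFun p t

end

/-!
A single jump dominates. The points with mark larger than `x` whose set `v + F` meets `(0, 1)` have
mean measure exactly `x ^ (-α)`, since `v + F` starts at `v`; the probability that such a point
exists is a lower bound for the tail.

For the upper bound, `v + F` meets an interval of length `h` with mass `O(h ^ (1 - β))`, so almost
surely the number of sets that overlap at a point of `(0, 1)` is bounded by a constant `m`. Hence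
`η ((0, 1)) > x` forces either a mark of size `x - o(x)` or two marks of size `x ^ (3 / 4)`, and the
latter has probability `O(x ^ (-3 * α / 2))`, which is negligible.

The hitting estimate compares the potential measure of the subordinator, a multiple of
`x ^ (β - 1) dx`, with its convolution with the intensity `v ^ (-β) dv` of the shifts, a multiple of
Lebesgue measure; both are identified through their Laplace transforms.
-/

section Preliminaries

lemma tsum_le_add_mul_of_subsingleton {ι : Type*} {f : ι → ℝ≥0∞} {y₁ y₂ : ℝ≥0∞} {m : ℕ}
    (hle : ∀ i, f i ≤ y₁) (hlarge : {i | y₂ < f i}.Subsingleton)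
    (hsupp : (Function.support f).encard ≤ m) :
    ∑' i, f i ≤ y₁ + m * y₂ := by
  have hsplit : ∀ i, f i ≤ {i | y₂ < f i}.indicator (fun _ => y₁) i +
      (Function.support f).indicator (fun _ => y₂) i := by
    intro i
    by_cases hi : y₂ < f i
    · rw [indicator_of_mem (by exact hi)]
      exact le_add_right (hle i)
    · by_cases h0 : f i = 0
      · simp [h0]
      · rw [indicator_of_mem (s := Function.support f) (by exact h0)]
        exact le_add_left (not_lt.1 hi)
  have hone : ({i | y₂ < f i}.encard : ℝ≥0∞) ≤ 1 := by
    exact_mod_cast encard_le_one_iff_subsingleton.2 hlarge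
  have hm : ((Function.support f).encard : ℝ≥0∞) ≤ m := by
    exact_mod_cast hsupp
  calc ∑' i, f i
      ≤ {i | y₂ < f i}.encard * y₁ + (Function.support f).encard * y₂ := by
        rw [← ENNReal.tsum_set_const, ← ENNReal.tsum_set_const, tsum_subtype _ fun _ => y₁,
          tsum_subtype _ fun _ => y₂, ← ENNReal.tsum_add]
        exact ENNReal.tsum_le_tsum hsplit
    _ ≤ 1 * y₁ + m * y₂ := by gcongr
    _ = y₁ + m * y₂ := by rw [one_mul]

lemma exists_mem_Ioo_div {t : ℝ≥0} (ht : t ∈ Ioo (0 : ℝ≥0) 1) (n : ℕ) :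
    ∃ k < n + 1, t ∈ Ioo ((k : ℝ≥0) / (n + 1)) (k / (n + 1) + 2 / (n + 1)) := by
  have hN : (0 : ℝ≥0) < (n : ℝ≥0) + 1 := by positivity
  have hceil : ⌈t * ((n : ℝ≥0) + 1)⌉₊ ≤ n + 1 := by
    rw [Nat.ceil_le]
    push_cast
    exact mul_le_of_le_one_left' ht.2.le
  obtain ⟨k, hk⟩ := Nat.exists_eq_succ_of_ne_zero (Nat.ceil_pos.2 (mul_pos ht.1 hN)).ne'
  refine ⟨k, by omega, ?_, ?_⟩
  · rw [div_lt_iff₀ hN]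
    exact Nat.lt_ceil.1 (by omega)
  · rw [← add_div, lt_div_iff₀ hN]
    calc t * ((n : ℝ≥0) + 1) ≤ (⌈t * ((n : ℝ≥0) + 1)⌉₊ : ℝ≥0) := Nat.le_ceil _
      _ = (k : ℝ≥0) + 1 := by rw [hk]; push_cast; rfl
      _ < k + 2 := by gcongr; norm_num

lemma tendsto_natCeil_mul_div_nhdsGE (t : ℝ≥0) {u : ℕ → ℝ≥0} (hu : Tendsto u atTop atTop) :
    Tendsto (fun n => (⌈t * u n⌉₊ : ℝ≥0) / u n) atTop (𝓝[≥] t) := by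
  refine tendsto_nhdsWithin_iff.2 ⟨?_, ?_⟩
  · have h := (tendsto_nat_ceil_mul_div_atTop t.coe_nonneg).comp (NNReal.tendsto_coe_atTop.2 hu)
    rw [← NNReal.tendsto_coe]
    refine h.congr fun n => ?_
    simp only [Function.comp_apply, ← NNReal.coe_mul, NNReal.coe_div, NNReal.coe_natCast]
    rfl
  · filter_upwards [hu.eventually_gt_atTop 0] with n hn
    exact (le_div_iff₀ hn).2 (Nat.le_ceil _)

lemma tendsto_two_pow_atTop : Tendsto (fun n : ℕ => (2 : ℝ≥0) ^ n) atTop atTop :=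
  tendsto_pow_atTop_atTop_of_one_lt one_lt_two

lemma measurable_uncurry_of_rightContinuous {Ω E : Type*} [MeasurableSpace Ω]
    [TopologicalSpace E] [TopologicalSpace.PseudoMetrizableSpace E] [MeasurableSpace E]
    [BorelSpace E] {X : ℝ≥0 → Ω → E} (hX : ∀ t, Measurable (X t))
    (hcont : ∀ ω t, ContinuousWithinAt (fun s => X s ω) (Ici t) t) :
    Measurable (Function.uncurry X) := by
  have happrox : ∀ n : ℕ, Measurable fun p : ℝ≥0 × Ω =>
      X ((⌈p.1 * 2 ^ n⌉₊ : ℝ≥0) / 2 ^ n) p.2 := fun n => by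
    have hgrid : Measurable fun q : ℕ × Ω => X ((q.1 : ℝ≥0) / 2 ^ n) q.2 :=
      measurable_from_prod_countable_right fun k => hX ((k : ℝ≥0) / 2 ^ n)
    have hceil : Measurable fun p : ℝ≥0 × Ω => ⌈p.1 * 2 ^ n⌉₊ :=
      (measurable_fst.mul_const _).nat_ceil
    exact hgrid.comp (hceil.prodMk measurable_snd)
  exact measurable_of_tendsto_metrizable happrox (tendsto_pi_nhds.2 fun p =>
    (hcont p.2 p.1).tendsto.comp (tendsto_natCeil_mul_div_nhdsGE p.1 tendsto_two_pow_atTop))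

lemma measurableSet_disjointed {Ω : Type*} {m : MeasurableSpace Ω} {f : Filtration ℕ m}
    {s : ℕ → Set Ω} (hs : ∀ k, MeasurableSet[f k] (s k)) (k : ℕ) :
    MeasurableSet[f k] (disjointed s k) := by
  rw [disjointed_eq_inter_compl]
  exact (hs k).inter (.iInter fun j => .iInter fun hj => (f.mono hj.le _ (hs j)).compl)

end Preliminaries

section Poisson

lemma poissonMeasure_Ici_le (r : ℝ≥0) (n : ℕ) : poissonMeasure r (Ici n) ≤ (r : ℝ≥0∞) ^ n := by
  have hIci : Ici n = ⋃ k : ℕ, {n + k} := by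
    ext k
    simpa only [mem_Ici, mem_iUnion, mem_singleton_iff] using le_iff_exists_add
  have hsingleton (k : ℕ) : poissonMeasure r {n + k} ≤ r ^ n * poissonMeasure r {k} := by
    have hfact : (k.factorial : ℝ) ≤ (n + k).factorial := by
      exact_mod_cast Nat.factorial_le (Nat.le_add_left k n)
    rw [poissonMeasure_singleton, poissonMeasure_singleton, ← ENNReal.ofReal_coe_nnreal,
      ← ENNReal.ofReal_pow r.coe_nonneg, ← ENNReal.ofReal_mul (by positivity)]
    refine ENNReal.ofReal_le_ofReal ?_
    calc Real.exp (-r) * (r : ℝ) ^ (n + k) / (n + k).factorial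
        ≤ Real.exp (-r) * (r : ℝ) ^ (n + k) / k.factorial := by gcongr
      _ = (r : ℝ) ^ n * (Real.exp (-r) * (r : ℝ) ^ k / k.factorial) := by ring
  have htotal : ∑' k : ℕ, poissonMeasure r {k} = 1 := by
    rw [← measure_iUnion (by simp [Pairwise, Function.onFun]) fun _ => .of_discrete,
      iUnion_of_singleton, measure_univ]
  calc poissonMeasure r (Ici n)
      ≤ ∑' k : ℕ, poissonMeasure r {n + k} := hIci ▸ measure_iUnion_le _
    _ ≤ ∑' k : ℕ, (r : ℝ≥0∞) ^ n * poissonMeasure r {k} := ENNReal.tsum_le_tsum hsingleton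
    _ = (r : ℝ≥0∞) ^ n := by rw [ENNReal.tsum_mul_left, htotal, mul_one]

lemma poissonLaw_Ici {M : ℝ≥0∞} (hM : M ≠ ∞) (n : ℕ) :
    poissonLaw M (Ici (n : ℕ∞)) = poissonMeasure M.toNNReal (Ici n) := by
  rw [poissonLaw, if_neg hM, Measure.map_apply .of_discrete .of_discrete]
  congr 1
  ext k
  simp

lemma poissonLaw_Ici_le (M : ℝ≥0∞) (n : ℕ) : poissonLaw M (Ici (n : ℕ∞)) ≤ M ^ n := by
  rcases eq_or_ne M ∞ with rfl | hM
  · rw [poissonLaw, if_pos rfl]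
    refine prob_le_one.trans ?_
    rcases n.eq_zero_or_pos with rfl | hn
    · simp
    · simp [hn.ne']
  · rw [poissonLaw_Ici hM]
    exact (poissonMeasure_Ici_le _ n).trans_eq (by rw [ENNReal.coe_toNNReal hM])

lemma pointCount_mono {Ω E : Type*} {X : ℕ → Ω → E} {B B' : Set E} (h : B ⊆ B') (ω : Ω) :
    pointCount X B ω ≤ pointCount X B' ω :=
  encard_le_encard fun _ hj => h hj

namespace IsPoissonEnumeration

variable {Ω E : Type*} [MeasurableSpace Ω] [MeasurableSpace E] {X : ℕ → Ω → E} {μ : Measure E}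
  {P : Measure Ω}

lemma measure_le_pointCount (hX : IsPoissonEnumeration X μ P) {B : Set E}
    (hB : MeasurableSet B) (n : ℕ) :
    P {ω | n ≤ pointCount X B ω} = poissonLaw (μ B) (Ici (n : ℕ∞)) :=
  (hX.hasLaw B hB).measure_eq (p := fun k => n ≤ k) .of_discrete

lemma measure_le_pointCount_le (hX : IsPoissonEnumeration X μ P) {B : Set E}
    (hB : MeasurableSet B) (n : ℕ) : P {ω | n ≤ pointCount X B ω} ≤ μ B ^ n :=
  (hX.measure_le_pointCount hB n).trans_le (poissonLaw_Ici_le _ n)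

lemma measureReal_one_le_pointCount (hX : IsPoissonEnumeration X μ P) {B : Set E}
    (hB : MeasurableSet B) (hμ : μ B ≠ ∞) :
    P.real {ω | 1 ≤ pointCount X B ω} = 1 - Real.exp (-(μ B).toReal) := by
  have hcompl : Ici 1 = ({0} : Set ℕ)ᶜ := by
    ext k
    simp [Nat.one_le_iff_ne_zero]
  have hlaw := hX.measure_le_pointCount hB 1
  rw [poissonLaw_Ici hμ, hcompl, Nat.cast_one] at hlaw
  rw [measureReal_def, hlaw, ← measureReal_def, probReal_compl_eq_one_sub .of_discrete,
    poissonMeasure_real_singleton]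
  simp [ENNReal.coe_toNNReal_eq_toReal]

lemma measure_exists_le_pointCount_le (hX : IsPoissonEnumeration X μ P) {ι : Type*} (I : Finset ι)
    {B : ι → Set E} (hB : ∀ i ∈ I, MeasurableSet (B i)) {q : ℝ≥0∞} (hq : ∀ i ∈ I, μ (B i) ≤ q)
    (m : ℕ) : P {ω | ∃ i ∈ I, m ≤ pointCount X (B i) ω} ≤ I.card * q ^ m := by
  have hunion : {ω | ∃ i ∈ I, m ≤ pointCount X (B i) ω} =
      ⋃ i ∈ I, {ω | m ≤ pointCount X (B i) ω} := by
    ext ω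
    simp
  rw [hunion, ← nsmul_eq_mul]
  refine (measure_biUnion_finset_le _ _).trans (Finset.sum_le_card_nsmul _ _ _ fun i hi => ?_)
  exact (hX.measure_le_pointCount_le (hB i hi) m).trans (by gcongr; exact hq i hi)

/- Cover `(0, 1)` by `n + 1` intervals of length `2 / (n + 1)`: since `γ * m > 1`, the union bound
over them is of order `n * n ^ (-γ * m)`, which tends to `0`. -/
lemma measure_exists_mem_Ioo_le_pointCount_eq_zero (hX : IsPoissonEnumeration X μ P)
    {S : ℝ≥0 → Set E} {C γ : ℝ} (hC : 0 ≤ C)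
    (hS : ∀ a h : ℝ≥0, 0 < h → ∃ B, MeasurableSet B ∧ (∀ t ∈ Ioo a (a + h), S t ⊆ B) ∧
      μ B ≤ ENNReal.ofReal (C * (h : ℝ) ^ γ)) {m : ℕ} (hm : 1 < γ * m) :
    P {ω | ∃ t ∈ Ioo (0 : ℝ≥0) 1, m ≤ pointCount X (S t) ω} = 0 := by
  choose! B hBm hBS hBμ using hS
  have hbound : ∀ n : ℕ, P {ω | ∃ t ∈ Ioo (0 : ℝ≥0) 1, m ≤ pointCount X (S t) ω} ≤
      ENNReal.ofReal ((C * 2 ^ γ) ^ m * ((n : ℝ) + 1) ^ (-(γ * m - 1))) := by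
    intro n
    have hN : (0 : ℝ) < (n : ℝ) + 1 := by positivity
    have hlen : (0 : ℝ≥0) < 2 / ((n : ℝ≥0) + 1) := by positivity
    calc P {ω | ∃ t ∈ Ioo (0 : ℝ≥0) 1, m ≤ pointCount X (S t) ω}
        ≤ P {ω | ∃ k ∈ Finset.range (n + 1),
            m ≤ pointCount X (B ((k : ℝ≥0) / (n + 1)) (2 / (n + 1))) ω} := by
          refine measure_mono ?_
          rintro ω ⟨t, ht, hmt⟩
          obtain ⟨k, hk, htk⟩ := exists_mem_Ioo_div ht n
          exact ⟨k, Finset.mem_range.2 hk, hmt.trans (pointCount_mono (hBS _ _ hlen t htk) ω)⟩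
      _ ≤ (Finset.range (n + 1)).card *
            ENNReal.ofReal (C * ((2 / ((n : ℝ≥0) + 1) : ℝ≥0) : ℝ) ^ γ) ^ m :=
          hX.measure_exists_le_pointCount_le _ (fun k _ => hBm _ _ hlen)
            (fun k _ => hBμ _ _ hlen) m
      _ = ENNReal.ofReal ((C * 2 ^ γ) ^ m * ((n : ℝ) + 1) ^ (-(γ * m - 1))) := by
          rw [Finset.card_range, ← ENNReal.ofReal_pow (by positivity), ← ENNReal.ofReal_natCast,
            ← ENNReal.ofReal_mul (by positivity)]
          congr 1
          push_cast
          rw [Real.div_rpow zero_le_two hN.le, mul_div_assoc', div_pow,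
            ← Real.rpow_natCast (((n : ℝ) + 1) ^ γ), ← Real.rpow_mul hN.le, neg_sub,
            Real.rpow_sub hN, Real.rpow_one]
          ring
  have hlim : Tendsto (fun n : ℕ => (C * 2 ^ γ) ^ m * ((n : ℝ) + 1) ^ (-(γ * m - 1))) atTop
      (𝓝 0) := by
    rw [← mul_zero ((C * 2 ^ γ) ^ m)]
    exact ((tendsto_rpow_neg_atTop (sub_pos.2 hm)).comp
      (tendsto_atTop_add_const_right _ 1 tendsto_natCast_atTop_atTop)).const_mul _
  refine le_antisymm (ge_of_tendsto' (x := atTop) ?_ hbound) zero_le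
  simpa using ENNReal.tendsto_ofReal hlim

end IsPoissonEnumeration

end Poisson

section LebesgueMeasure

lemma measurableEmbedding_nnrealCoe : MeasurableEmbedding ((↑) : ℝ≥0 → ℝ) :=
  .subtype_coe measurableSet_Ici

instance : SFinite lebesguePos := by
  unfold lebesguePos
  infer_instance

lemma map_coe_lebesguePos :
    lebesguePos.map ((↑) : ℝ≥0 → ℝ) = (volume : Measure ℝ).restrict (Ici 0) := by
  have hid : (fun x : ℝ => ((x.toNNReal : ℝ≥0) : ℝ)) =ᵐ[volume.restrict (Ici 0)] id :=
    (ae_restrict_iff' measurableSet_Ici).2 (.of_forall fun x hx => Real.coe_toNNReal x hx)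
  rw [lebesguePos, Measure.map_map measurable_coe_nnreal_real measurable_real_toNNReal]
  exact (Measure.map_congr hid).trans Measure.map_id

lemma lebesguePos_preimage_coe {s : Set ℝ} (hs : s ⊆ Ici 0) :
    lebesguePos ((↑) ⁻¹' s) = volume s := by
  rw [← measurableEmbedding_nnrealCoe.map_apply, map_coe_lebesguePos,
    Measure.restrict_eq_self _ hs]

instance : NullSingletonClass lebesguePos := ⟨fun x => by
  have hx : ({x} : Set ℝ≥0) = (↑) ⁻¹' {(x : ℝ)} := by
    ext y
    simp
  rw [hx, lebesguePos_preimage_coe (by simp), measure_singleton]⟩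

lemma setLIntegral_preimage_coe_lebesguePos {s : Set ℝ} (hs : s ⊆ Ici 0) (f : ℝ → ℝ≥0∞) :
    ∫⁻ x in ((↑) : ℝ≥0 → ℝ) ⁻¹' s, f x ∂lebesguePos = ∫⁻ x in s, f x := by
  rw [← measurableEmbedding_nnrealCoe.lintegral_map (f := f),
    ← measurableEmbedding_nnrealCoe.restrict_map, map_coe_lebesguePos,
    Measure.restrict_restrict_of_subset hs]

lemma map_const_add_lebesguePos (a : ℝ≥0) :
    lebesguePos.map (a + ·) = lebesguePos.restrict (Ici a) := by
  refine Measure.ext fun B hB => ?_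
  set s : Set ℝ := (↑) '' (B ∩ Ici a) with hs
  have hright : B ∩ Ici a = ((↑) : ℝ≥0 → ℝ) ⁻¹' s :=
    (preimage_image_eq _ NNReal.coe_injective).symm
  have hleft : (a + ·) ⁻¹' B = ((↑) : ℝ≥0 → ℝ) ⁻¹' (((a : ℝ) + ·) ⁻¹' s) := by
    ext x
    simp [hs, ← NNReal.coe_add]
  have hs0 : s ⊆ Ici 0 := by
    rintro _ ⟨y, -, rfl⟩
    exact y.coe_nonneg
  have hs0' : ((a : ℝ) + ·) ⁻¹' s ⊆ Ici 0 := by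
    rintro x ⟨y, hy, hyx⟩
    exact nonneg_of_le_add_right (hyx ▸ NNReal.coe_le_coe.2 hy.2)
  rw [Measure.map_apply (measurable_const_add a) hB, Measure.restrict_apply hB, hright, hleft,
    lebesguePos_preimage_coe hs0, lebesguePos_preimage_coe hs0', measure_preimage_add]

end LebesgueMeasure

section PowerMeasure

/-- The measure `c x ^ a dx` on `ℝ₊`. The mean measure is built from two of these, and the
potential measure of a stable subordinator is a third one. -/
noncomputable def powerMeasure (c a : ℝ) : Measure ℝ≥0 :=
  lebesguePos.withDensity fun x => ENNReal.ofReal (c * (x : ℝ) ^ a)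

instance (c a : ℝ) : SFinite (powerMeasure c a) := by
  unfold powerMeasure
  infer_instance

instance (c a : ℝ) : NullSingletonClass (powerMeasure c a) := by
  unfold powerMeasure
  infer_instance

lemma meanMeasure_eq_prod (α β : ℝ) (ν : Measure ClosedSubset) :
    meanMeasure α β ν = (powerMeasure α (-(1 + α))).prod ((powerMeasure (1 - β) (-β)).prod ν) :=
  rfl

lemma powerMeasure_one_zero : powerMeasure 1 0 = lebesguePos := by
  simp [powerMeasure]

lemma powerMeasure_preimage_coe {c a : ℝ} (hc : 0 ≤ c) {s : Set ℝ} (hs : s ⊆ Ici 0)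
    (hsm : MeasurableSet s) (hint : IntegrableOn (fun x => x ^ a) s) :
    powerMeasure c a ((↑) ⁻¹' s) = ENNReal.ofReal (c * ∫ x in s, x ^ a) := by
  rw [powerMeasure, withDensity_apply _ (measurable_coe_nnreal_real hsm),
    setLIntegral_preimage_coe_lebesguePos hs fun x => ENNReal.ofReal (c * x ^ a),
    ← integral_const_mul, ofReal_integral_eq_lintegral_ofReal (hint.const_mul c)]
  exact (ae_restrict_iff' hsm).2 (.of_forall fun x hx => mul_nonneg hc (Real.rpow_nonneg (hs hx) a))

lemma powerMeasure_Ioi {c a : ℝ} (hc : 0 ≤ c) (ha : a < -1) {x : ℝ≥0} (hx : 0 < x) :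
    powerMeasure c a (Ioi x) = ENNReal.ofReal (c * (-(x : ℝ) ^ (a + 1) / (a + 1))) := by
  have hpre : Ioi x = (↑) ⁻¹' Ioi (x : ℝ) := by
    ext y
    simp
  have hx' : (0 : ℝ) < x := hx
  rw [hpre, powerMeasure_preimage_coe hc (Ioi_subset_Ici x.coe_nonneg) measurableSet_Ioi
    (integrableOn_Ioi_rpow_of_lt ha hx'), integral_Ioi_rpow_of_lt ha hx']

lemma powerMeasure_Iic {c a : ℝ} (hc : 0 ≤ c) (ha : -1 < a) (x : ℝ≥0) :
    powerMeasure c a (Iic x) = ENNReal.ofReal (c * ((x : ℝ) ^ (a + 1) / (a + 1))) := by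
  have hpre : Iic x = (↑) ⁻¹' Icc 0 (x : ℝ) := by
    ext y
    simp
  have hint := intervalIntegral.intervalIntegrable_rpow' (a := 0) (b := x) ha
  rw [intervalIntegrable_iff_integrableOn_Icc_of_le x.coe_nonneg] at hint
  rw [hpre, powerMeasure_preimage_coe hc Icc_subset_Ici_self measurableSet_Icc hint,
    integral_Icc_eq_integral_Ioc, ← intervalIntegral.integral_of_le x.coe_nonneg,
    integral_rpow (.inl ha), Real.zero_rpow (by linarith), sub_zero]

lemma powerMeasure_Ioo_zero {c a : ℝ} (hc : 0 ≤ c) (ha : -1 < a) (x : ℝ≥0) :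
    powerMeasure c a (Ioo 0 x) = ENNReal.ofReal (c * ((x : ℝ) ^ (a + 1) / (a + 1))) := by
  rw [measure_congr Ioo_ae_eq_Icc, ← bot_eq_zero, Icc_bot, powerMeasure_Iic hc ha]

lemma powerMeasure_zero_exponent_Ioo {c : ℝ} (hc : 0 ≤ c) {a b : ℝ≥0} (hab : a ≤ b) :
    powerMeasure c 0 (Ioo a b) = ENNReal.ofReal (c * (b - a)) := by
  have hpre : Ioo a b = (↑) ⁻¹' Ioo (a : ℝ) b := by
    ext y
    simp
  rw [hpre, powerMeasure_preimage_coe hc (fun x hx => a.coe_nonneg.trans hx.1.le)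
    measurableSet_Ioo (by simp)]
  simp [hab]

end PowerMeasure

section LaplaceTransform

/-- The Laplace transform `l ↦ ∫ exp (-l x) μ(dx)` of a measure on `ℝ₊`, with values in `[0, ∞]` so
that infinite measures such as potential measures are allowed. -/
noncomputable def laplaceTransform (μ : Measure ℝ≥0) (l : ℝ) : ℝ≥0∞ :=
  ∫⁻ x, ENNReal.ofReal (Real.exp (-(l * x))) ∂μ

lemma laplaceTransform_powerMeasure {c a l : ℝ} (hc : 0 ≤ c) (ha : -1 < a) (hl : 0 < l) :
    laplaceTransform (powerMeasure c a) l =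
      ENNReal.ofReal (c * ((1 / l) ^ (a + 1) * Real.Gamma (a + 1))) := by
  have ha' : 0 < a + 1 := by linarith
  have hgamma := Real.integral_rpow_mul_exp_neg_mul_Ioi ha' hl
  have hint : IntegrableOn (fun x : ℝ => x ^ (a + 1 - 1) * Real.exp (-(l * x))) (Ioi 0) := by
    refine Integrable.of_integral_ne_zero (hgamma ▸ ?_)
    have := Real.Gamma_pos_of_pos ha'
    positivity
  have huniv : (univ : Set ℝ≥0) = (↑) ⁻¹' Ici (0 : ℝ) := by
    ext x
    simp
  calc laplaceTransform (powerMeasure c a) l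
      = ∫⁻ x in ((↑) : ℝ≥0 → ℝ) ⁻¹' Ici 0,
          ENNReal.ofReal (c * ((x : ℝ) ^ (a + 1 - 1) * Real.exp (-(l * x)))) ∂lebesguePos := by
        rw [laplaceTransform, powerMeasure,
          lintegral_withDensity_eq_lintegral_mul _ (by fun_prop) (by fun_prop), ← huniv,
          setLIntegral_univ]
        refine lintegral_congr fun x => ?_
        rw [Pi.mul_apply, ← ENNReal.ofReal_mul (by positivity), add_sub_cancel_right, mul_assoc]
    _ = ∫⁻ x in Ioi (0 : ℝ), ENNReal.ofReal (c * (x ^ (a + 1 - 1) * Real.exp (-(l * x)))) := by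
        rw [setLIntegral_preimage_coe_lebesguePos subset_rfl
          fun x => ENNReal.ofReal (c * (x ^ (a + 1 - 1) * Real.exp (-(l * x))))]
        exact setLIntegral_congr Ioi_ae_eq_Ici.symm
    _ = ENNReal.ofReal (c * ((1 / l) ^ (a + 1) * Real.Gamma (a + 1))) := by
        rw [← hgamma, ← integral_const_mul, ofReal_integral_eq_lintegral_ofReal (hint.const_mul c)]
        refine (ae_restrict_iff' measurableSet_Ioi).2 (.of_forall fun x hx => ?_)
        have : 0 < x := hx
        positivity

lemma laplaceTransform_conv (μ ν : Measure ℝ≥0) [SFinite ν] (l : ℝ) :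
    laplaceTransform (μ ∗ ν) l = laplaceTransform μ l * laplaceTransform ν l := by
  simp only [laplaceTransform]
  rw [Measure.lintegral_conv (by fun_prop), ← lintegral_mul_const _ (by fun_prop)]
  refine lintegral_congr fun x => ?_
  rw [← lintegral_const_mul _ (by fun_prop)]
  refine lintegral_congr fun y => ?_
  rw [← ENNReal.ofReal_mul (Real.exp_nonneg _), ← Real.exp_add, NNReal.coe_add]
  congr 2
  ring

lemma laplaceTransform_withDensity_exp (μ : Measure ℝ≥0) (l₀ l : ℝ) :
    laplaceTransform (μ.withDensity fun x => ENNReal.ofReal (Real.exp (-(l₀ * x)))) l =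
      laplaceTransform μ (l₀ + l) := by
  rw [laplaceTransform, lintegral_withDensity_eq_lintegral_mul _ (by fun_prop) (by fun_prop)]
  refine lintegral_congr fun x => ?_
  rw [Pi.mul_apply, ← ENNReal.ofReal_mul (Real.exp_nonneg _), ← Real.exp_add]
  congr 2
  ring

lemma integral_exp_neg_pow_eq_laplaceTransform (μ : Measure ℝ≥0) (n : ℕ) :
    ∫ x : ℝ≥0, Real.exp (-x) ^ n ∂μ = (laplaceTransform μ n).toReal := by
  rw [integral_eq_lintegral_of_nonneg_ae (.of_forall fun x => by positivity) (by fun_prop)]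
  simp only [laplaceTransform, ← Real.exp_nat_mul, mul_neg]

-- The polynomials in `exp (-x)` separate points, so Stone–Weierstrass applies.
lemma ext_of_laplaceTransform_natCast_eq {μ ν : Measure ℝ≥0} [IsFiniteMeasure μ]
    [IsFiniteMeasure ν] (h : ∀ n : ℕ, laplaceTransform μ n = laplaceTransform ν n) : μ = ν := by
  let g : BoundedContinuousFunction ℝ≥0 ℝ := .ofNormedAddCommGroup (fun x : ℝ≥0 => Real.exp (-x))
    (by fun_prop) 1 fun x => by simp
  have hstar (f : BoundedContinuousFunction ℝ≥0 ℝ) : star f = f := by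
    ext x
    simp
  let A : StarSubalgebra ℝ (BoundedContinuousFunction ℝ≥0 ℝ) :=
    { Algebra.adjoin ℝ {g} with star_mem' := fun {f} hf => (hstar f).symm ▸ hf }
  have hg : g ∈ A := Algebra.self_mem_adjoin_singleton ℝ g
  have hsep : (A.map (BoundedContinuousFunction.toContinuousMapStarₐ ℝ)).SeparatesPoints := by
    intro x y hxy
    refine ⟨g, ⟨_, ⟨g, hg, rfl⟩, rfl⟩, fun hexp => hxy ?_⟩
    simpa [g] using hexp
  refine ext_of_forall_mem_subalgebra_integral_eq_of_pseudoEMetric_complete_countable hsep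
    fun f hf => ?_
  obtain ⟨p, rfl⟩ : ∃ p, Polynomial.aeval g p = f :=
    (Algebra.adjoin_singleton_eq_range_aeval ℝ g).le hf
  have hmoment (n : ℕ) : ∫ x, (g ^ n) x ∂μ = ∫ x, (g ^ n) x ∂ν :=
    (integral_exp_neg_pow_eq_laplaceTransform μ n).trans
      (h n ▸ (integral_exp_neg_pow_eq_laplaceTransform ν n).symm)
  have hintegral (ρ : Measure ℝ≥0) [IsFiniteMeasure ρ] : ∫ x, Polynomial.aeval g p x ∂ρ =
      ∑ n ∈ Finset.range (p.natDegree + 1), p.coeff n * ∫ x, (g ^ n) x ∂ρ := by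
    rw [Polynomial.aeval_eq_sum_range]
    simp only [BoundedContinuousFunction.coe_sum, Finset.sum_apply,
      BoundedContinuousFunction.coe_smul, smul_eq_mul]
    rw [integral_finsetSum _ fun n _ =>
      (BoundedContinuousFunction.integrable ρ (g ^ n)).const_mul _]
    simp only [integral_const_mul]
  rw [hintegral, hintegral, Finset.sum_congr rfl fun n _ => by rw [hmoment n]]

lemma ext_of_laplaceTransform_eq {μ ν : Measure ℝ≥0} {l₀ : ℝ} (hfin : laplaceTransform μ l₀ ≠ ∞)
    (h : ∀ l, l₀ ≤ l → laplaceTransform μ l = laplaceTransform ν l) : μ = ν := by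
  let f : ℝ≥0 → ℝ≥0∞ := fun x => ENNReal.ofReal (Real.exp (-(l₀ * x)))
  have hf : Measurable f := by fun_prop
  have huniv (ρ : Measure ℝ≥0) : ρ.withDensity f univ = laplaceTransform ρ l₀ := by
    rw [withDensity_apply _ .univ, setLIntegral_univ, laplaceTransform]
  have hinv (ρ : Measure ℝ≥0) : (ρ.withDensity f).withDensity f⁻¹ = ρ :=
    withDensity_inv_same hf (.of_forall fun x => by simp [f, Real.exp_pos])
      (.of_forall fun x => by simp [f])
  have : IsFiniteMeasure (μ.withDensity f) := ⟨by rw [huniv]; exact hfin.lt_top⟩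
  have : IsFiniteMeasure (ν.withDensity f) := ⟨by rw [huniv, ← h l₀ le_rfl]; exact hfin.lt_top⟩
  have htilt : μ.withDensity f = ν.withDensity f :=
    ext_of_laplaceTransform_natCast_eq fun n => by
      simp only [f, laplaceTransform_withDensity_exp]
      exact h _ (le_add_of_nonneg_right n.cast_nonneg)
  rw [← hinv μ, htilt, hinv]

lemma powerMeasure_conv_powerMeasure {c d a b : ℝ} (hc : 0 ≤ c) (hd : 0 ≤ d) (ha : -1 < a)
    (hb : -1 < b) : powerMeasure c a ∗ powerMeasure d b =
      powerMeasure (c * d * (Real.Gamma (a + 1) * Real.Gamma (b + 1) / Real.Gamma (a + b + 2)))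
        (a + b + 1) := by
  have hΓa : 0 < Real.Gamma (a + 1) := Real.Gamma_pos_of_pos (by linarith)
  have hΓb : 0 < Real.Gamma (b + 1) := Real.Gamma_pos_of_pos (by linarith)
  have hΓ : 0 < Real.Gamma (a + b + 2) := Real.Gamma_pos_of_pos (by linarith)
  refine ext_of_laplaceTransform_eq (l₀ := 1) ?_ fun l hl => ?_
  · rw [laplaceTransform_conv, laplaceTransform_powerMeasure hc ha one_pos,
      laplaceTransform_powerMeasure hd hb one_pos]
    exact ENNReal.mul_ne_top ENNReal.ofReal_ne_top ENNReal.ofReal_ne_top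
  have hl0 : 0 < l := one_pos.trans_le hl
  have hpow : (1 / l) ^ (a + b + 1 + 1) = (1 / l) ^ (a + 1) * (1 / l) ^ (b + 1) := by
    rw [← Real.rpow_add (one_div_pos.2 hl0)]
    ring_nf
  rw [laplaceTransform_conv, laplaceTransform_powerMeasure hc ha hl0,
    laplaceTransform_powerMeasure hd hb hl0,
    laplaceTransform_powerMeasure (by positivity) (by linarith) hl0,
    ← ENNReal.ofReal_mul (by positivity), hpow, add_assoc (a + b), one_add_one_eq_two]
  congr 1
  field_simp

lemma powerMeasure_neg_conv_powerMeasure_sub_one {c d b : ℝ} (hc : 0 ≤ c) (hd : 0 ≤ d)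
    (hb : b ∈ Ioo (0 : ℝ) 1) : powerMeasure c (-b) ∗ powerMeasure d (b - 1) =
      powerMeasure (c * d * (Real.Gamma (1 - b) * Real.Gamma b)) 0 := by
  rw [powerMeasure_conv_powerMeasure hc hd (by linarith [hb.2]) (by linarith [hb.1])]
  congr 1
  · rw [neg_add_eq_sub, sub_add_cancel, show -b + (b - 1) + 2 = 1 by ring, Real.Gamma_one, div_one]
  · ring

end LaplaceTransform

section Subordinator

/-- `σ` is a subordinator under `P`: a process started at `0` with nondecreasing right-continuous
paths and stationary independent increments. The hitting estimates below hold at this generality;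
stability only enters through the Laplace exponent. -/
structure IsSubordinator {Ω : Type*} [MeasurableSpace Ω] (σ : ℝ≥0 → Ω → ℝ≥0) (P : Measure Ω) :
    Prop where
  measurable : ∀ t, Measurable (σ t)
  zero : ∀ ω, σ 0 ω = 0
  monotone : ∀ ω, Monotone fun t => σ t ω
  rightContinuous : ∀ ω t, ContinuousWithinAt (fun s => σ s ω) (Ici t) t
  indepIncrements : HasIndepIncrements σ P
  stationaryIncrements : ∀ s t, IdentDistrib (fun ω => σ (s + t) ω - σ s ω) (σ t) P P

/-- The potential measure `B ↦ 𝔼 ∫ 1{σ t ∈ B} dt` of a process `σ`, its expected occupation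
measure. -/
noncomputable def potentialMeasure {Ω : Type*} [MeasurableSpace Ω] (σ : ℝ≥0 → Ω → ℝ≥0)
    (P : Measure Ω) : Measure ℝ≥0 :=
  (lebesguePos.prod P).map fun p => σ p.1 p.2

instance {Ω : Type*} [MeasurableSpace Ω] (σ : ℝ≥0 → Ω → ℝ≥0) (P : Measure Ω) [SFinite P] :
    SFinite (potentialMeasure σ P) := by
  unfold potentialMeasure
  infer_instance

variable {Ω : Type*} [mΩ : MeasurableSpace Ω] {σ : ℝ≥0 → Ω → ℝ≥0} {P : Measure Ω}

namespace IsSubordinator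

lemma measurable_uncurry (hσ : IsSubordinator σ P) : Measurable fun p : ℝ≥0 × Ω => σ p.1 p.2 :=
  measurable_uncurry_of_rightContinuous hσ.measurable hσ.rightContinuous

lemma indep_past_increment (hσ : IsSubordinator σ P) {τ : ℕ → ℝ≥0} (hτ : Monotone τ)
    (hτ0 : τ 0 = 0) (k : ℕ) (s : ℝ≥0) :
    Indep (Filtration.natural (fun j => σ (τ j))
        (fun j => (hσ.measurable (τ j)).stronglyMeasurable) k)
      (MeasurableSpace.comap (fun ω => σ (τ k + s) ω - σ (τ k) ω) inferInstance) P := by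
  let t : ℕ → ℝ≥0 := fun i => if i ≤ k then τ i else τ k + s
  have ht : Monotone t := monotone_nat_of_le_succ fun i => by
    rcases lt_trichotomy i k with hi | rfl | hi
    · simpa [t, hi.le, Nat.succ_le_iff.2 hi] using hτ i.le_succ
    · simp [t]
    · simp [t, hi.not_ge, (hi.trans i.lt_succ_self).not_ge]
  let D : ℕ → Ω → ℝ≥0 := fun i ω => σ (t (i + 1)) ω - σ (t i) ω
  have hD : ∀ i, Measurable (D i) := fun i => (hσ.measurable _).sub (hσ.measurable _)
  have hindep := indep_iSup_of_disjoint (fun i => (hD i).comap_le)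
    (hσ.indepIncrements.nat ht).iIndep (Iio_disjoint_Ici (le_refl k))
  refine indep_of_indep_of_le_left (indep_of_indep_of_le_right hindep ?_) (iSup₂_le fun j hj => ?_)
  · have hlast : D k = fun ω => σ (τ k + s) ω - σ (τ k) ω := by simp [D, t]
    exact hlast ▸ le_iSup₂_of_le k self_mem_Ici le_rfl
  · have htelescope : σ (τ j) = fun ω => ∑ i ∈ Finset.range j, D i ω := by
      funext ω
      have hj' : j ≤ k := hj
      have hmono : Monotone fun i => σ (t i) ω := (hσ.monotone ω).comp ht
      rw [Finset.sum_range_tsub hmono j]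
      simp [t, hj', hτ0, hσ.zero]
    change MeasurableSpace.comap (σ (τ j)) _ ≤ _
    rw [htelescope, ← measurable_iff_comap_le]
    refine Finset.measurable_sum _ fun i hi => ?_
    exact (comap_measurable (D i)).mono
      (le_iSup₂_of_le i (lt_of_lt_of_le (Finset.mem_range.1 hi) hj) le_rfl) le_rfl

lemma measure_inter_increment_le (hσ : IsSubordinator σ P) {τ : ℕ → ℝ≥0} (hτ : Monotone τ)
    (hτ0 : τ 0 = 0) {k : ℕ} {A : Set Ω}
    (hA : MeasurableSet[Filtration.natural (fun j => σ (τ j))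
      (fun j => (hσ.measurable (τ j)).stronglyMeasurable) k] A) (s h : ℝ≥0) :
    P (A ∩ {ω | σ (τ k + s) ω - σ (τ k) ω ≤ h}) = P A * P {ω | σ s ω ≤ h} :=
  ((Indep_iff _ _ P).1 (hσ.indep_past_increment hτ hτ0 k s) A _ hA
    ⟨Iic h, measurableSet_Iic, rfl⟩).trans
      (congrArg _ ((hσ.stationaryIncrements (τ k) s).measure_mem_eq measurableSet_Iic))

lemma measurableSet_increment_le (hσ : IsSubordinator σ P) {A : Set Ω} (hA : MeasurableSet A)
    (a h : ℝ≥0) : MeasurableSet {p : ℝ≥0 × Ω | p.2 ∈ A ∧ σ p.1 p.2 - σ a p.2 ≤ h} :=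
  have hincrement : Measurable fun p : ℝ≥0 × Ω => σ p.1 p.2 - σ a p.2 :=
    hσ.measurable_uncurry.sub ((hσ.measurable a).comp measurable_snd)
  (measurable_snd hA).inter (hincrement measurableSet_Iic)

variable [SFinite P]

lemma measure_mul_potentialMeasure_Iic (hσ : IsSubordinator σ P) {A : Set Ω}
    (hA : MeasurableSet A) {a h : ℝ≥0}
    (hindep : ∀ s, P (A ∩ {ω | σ (a + s) ω - σ a ω ≤ h}) = P A * P {ω | σ s ω ≤ h}) :
    P A * potentialMeasure σ P (Iic h) = (lebesguePos.prod P)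
      ({p | p.2 ∈ A ∧ σ p.1 p.2 - σ a p.2 ≤ h} ∩ Ici a ×ˢ univ) := by
  have hmeas := hσ.measurableSet_increment_le hA a h
  have hlevel : MeasurableSet {p : ℝ≥0 × Ω | σ p.1 p.2 ≤ h} :=
    hσ.measurable_uncurry measurableSet_Iic
  have hrestrict : (lebesguePos.prod P).restrict (Ici a ×ˢ univ) =
      (lebesguePos.map (a + ·)).prod P := by
    rw [← Measure.prod_restrict, Measure.restrict_univ, map_const_add_lebesguePos]
  calc P A * potentialMeasure σ P (Iic h)
      = P A * ∫⁻ s, P {ω | σ s ω ≤ h} ∂lebesguePos := by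
        rw [potentialMeasure, Measure.map_apply hσ.measurable_uncurry measurableSet_Iic]
        exact congrArg _ (Measure.prod_apply hlevel)
    _ = ∫⁻ s, P (A ∩ {ω | σ (a + s) ω - σ a ω ≤ h}) ∂lebesguePos := by
        have hmeas_level : Measurable fun s => P {ω | σ s ω ≤ h} :=
          measurable_measure_prodMk_left hlevel
        rw [← lintegral_const_mul _ hmeas_level]
        exact lintegral_congr fun s => (hindep s).symm
    _ = ((lebesguePos.map (a + ·)).prod P) {p | p.2 ∈ A ∧ σ p.1 p.2 - σ a p.2 ≤ h} := by
        rw [Measure.prod_apply hmeas,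
          lintegral_map (measurable_measure_prodMk_left hmeas) (measurable_const_add a)]
        rfl
    _ = _ := by rw [← hrestrict, Measure.restrict_apply hmeas]

-- After the first time `τ k` at which it visits `H`, the process restarts afresh, and the time it
-- then takes to advance by `h` is spent inside `H'`.
lemma measure_exists_mem_mul_potentialMeasure_le (hσ : IsSubordinator σ P) {τ : ℕ → ℝ≥0}
    (hτ : Monotone τ) (hτ0 : τ 0 = 0) {H H' : Set ℝ≥0} (hH : MeasurableSet H)
    (hH' : MeasurableSet H') {h : ℝ≥0} (hadd : ∀ r ∈ H, ∀ s ≤ h, r + s ∈ H') :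
    P {ω | ∃ k, σ (τ k) ω ∈ H} * potentialMeasure σ P (Iic h) ≤ potentialMeasure σ P H' := by
  let visit : ℕ → Set Ω := fun k => σ (τ k) ⁻¹' H
  let first : ℕ → Set Ω := disjointed visit
  let past : Filtration ℕ mΩ := .natural (fun j => σ (τ j))
    (fun j => (hσ.measurable (τ j)).stronglyMeasurable)
  have hfirst (k : ℕ) : MeasurableSet[past k] (first k) := measurableSet_disjointed
    (fun k => (Filtration.stronglyAdapted_natural _ k).measurable hH) k
  have hfirst' (k : ℕ) : MeasurableSet (first k) := past.le k _ (hfirst k)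
  let C : ℕ → Set (ℝ≥0 × Ω) := fun k =>
    {p | p.2 ∈ first k ∧ σ p.1 p.2 - σ (τ k) p.2 ≤ h} ∩ Ici (τ k) ×ˢ univ
  have hC (k : ℕ) : MeasurableSet (C k) := (hσ.measurableSet_increment_le (hfirst' k) _ h).inter
    (measurableSet_Ici.prod .univ)
  have hCdisj : Pairwise (Function.onFun Disjoint C) := fun i j hij =>
    disjoint_left.2 fun p hi hj => disjoint_left.1 (disjoint_disjointed visit hij) hi.1.1 hj.1.1
  have hCsub : ⋃ k, C k ⊆ (fun p => σ p.1 p.2) ⁻¹' H' := by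
    refine iUnion_subset fun k p ⟨⟨hfirst, hinc⟩, htime, _⟩ => ?_
    have hstart : σ (τ k) p.2 ∈ H := disjointed_subset visit k hfirst
    simpa only [mem_preimage, add_tsub_cancel_of_le (hσ.monotone p.2 htime)]
      using hadd _ hstart _ hinc
  have hunion : {ω | ∃ k, σ (τ k) ω ∈ H} = ⋃ k, first k := by
    rw [iUnion_disjointed]
    ext ω
    simp [visit]
  calc P {ω | ∃ k, σ (τ k) ω ∈ H} * potentialMeasure σ P (Iic h)
      = ∑' k, P (first k) * potentialMeasure σ P (Iic h) := by
        rw [hunion, measure_iUnion (disjoint_disjointed visit) hfirst', ENNReal.tsum_mul_right]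
    _ = ∑' k, (lebesguePos.prod P) (C k) := tsum_congr fun k =>
        hσ.measure_mul_potentialMeasure_Iic (hfirst' k) fun s =>
          hσ.measure_inter_increment_le hτ hτ0 (hfirst k) s h
    _ = (lebesguePos.prod P) (⋃ k, C k) := (measure_iUnion hCdisj hC).symm
    _ ≤ (lebesguePos.prod P) ((fun p => σ p.1 p.2) ⁻¹' H') := measure_mono hCsub
    _ = potentialMeasure σ P H' := (Measure.map_apply hσ.measurable_uncurry hH').symm

lemma measure_range_inter_mul_potentialMeasure_le (hσ : IsSubordinator σ P) {H H' : Set ℝ≥0}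
    (hH : IsOpen H) (hH' : MeasurableSet H') {h : ℝ≥0} (hadd : ∀ r ∈ H, ∀ s ≤ h, r + s ∈ H') :
    P {ω | (range (fun t => σ t ω) ∩ H).Nonempty} * potentialMeasure σ P (Iic h) ≤
      potentialMeasure σ P H' := by
  let S : ℕ → Set Ω := fun n => {ω | ∃ k : ℕ, σ ((k : ℝ≥0) / 2 ^ n) ω ∈ H}
  have hS : Monotone S := monotone_nat_of_le_succ fun n ω ⟨k, hk⟩ => by
    refine ⟨2 * k, ?_⟩
    rwa [Nat.cast_mul, Nat.cast_two, pow_succ', mul_div_mul_left _ _ two_ne_zero]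
  have hcover : {ω | (range (fun t => σ t ω) ∩ H).Nonempty} ⊆ ⋃ n, S n := by
    rintro ω ⟨_, ⟨t, rfl⟩, ht⟩
    have hlim := (hσ.rightContinuous ω t).tendsto.comp
      (tendsto_natCeil_mul_div_nhdsGE t tendsto_two_pow_atTop)
    obtain ⟨n, hn⟩ := (hlim.eventually (hH.mem_nhds ht)).exists
    exact mem_iUnion.2 ⟨n, _, hn⟩
  have hgrid (n : ℕ) : Monotone fun k : ℕ => (k : ℝ≥0) / 2 ^ n := fun i j hij => by
    simp only
    gcongr
  calc P {ω | (range (fun t => σ t ω) ∩ H).Nonempty} * potentialMeasure σ P (Iic h)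
      ≤ P (⋃ n, S n) * potentialMeasure σ P (Iic h) := by gcongr
    _ = ⨆ n, P (S n) * potentialMeasure σ P (Iic h) := by
        rw [hS.measure_iUnion, ENNReal.iSup_mul]
    _ ≤ potentialMeasure σ P H' := iSup_le fun n =>
        hσ.measure_exists_mem_mul_potentialMeasure_le (hgrid n) (by simp) hH.measurableSet hH' hadd

lemma laplaceTransform_potentialMeasure (hσ : IsSubordinator σ P) {l q : ℝ} (hq : 0 < q)
    (hlaplace : ∀ t, ∫⁻ ω, ENNReal.ofReal (Real.exp (-(l * σ t ω))) ∂P =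
      ENNReal.ofReal (Real.exp (-(q * t)))) :
    laplaceTransform (potentialMeasure σ P) l = ENNReal.ofReal (1 / q) := by
  have hmeas := hσ.measurable_uncurry
  rw [laplaceTransform, potentialMeasure, lintegral_map (by fun_prop) hmeas,
    lintegral_prod _ (by fun_prop)]
  simp only [hlaplace]
  calc ∫⁻ t, ENNReal.ofReal (Real.exp (-(q * t))) ∂lebesguePos
      = laplaceTransform (powerMeasure 1 0) q := by rw [powerMeasure_one_zero, laplaceTransform]
    _ = ENNReal.ofReal (1 / q) := by
        simp [laplaceTransform_powerMeasure zero_le_one (by norm_num : (-1 : ℝ) < 0) hq]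

end IsSubordinator

namespace IsStableSubordinator

variable {β : ℝ}

lemma isSubordinator (hσ : IsStableSubordinator β σ P) : IsSubordinator σ P where
  measurable := hσ.measurable
  zero := hσ.zero
  monotone := hσ.monotone
  rightContinuous := hσ.rightContinuous
  indepIncrements := hσ.indepIncrements
  stationaryIncrements := hσ.stationaryIncrements

lemma exists_potentialMeasure_eq [IsFiniteMeasure P] (hσ : IsStableSubordinator β σ P)
    (hβ : 0 < β) :
    ∃ c : ℝ, 0 < c ∧ potentialMeasure σ P = powerMeasure (c / Real.Gamma β) (β - 1) := by
  obtain ⟨c, hc, hlaplace⟩ := hσ.laplace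
  have := Real.Gamma_pos_of_pos hβ
  have hpot : ∀ l : ℝ, 1 ≤ l →
      laplaceTransform (potentialMeasure σ P) l = ENNReal.ofReal (1 / (c * l ^ β)) := by
    intro l hl
    have hl0 : 0 < l := one_pos.trans_le hl
    refine hσ.isSubordinator.laplaceTransform_potentialMeasure (by positivity) fun t => ?_
    lift l to ℝ≥0 using hl0.le
    have hint : Integrable (fun ω => Real.exp (-((l : ℝ) * σ t ω))) P :=
      .of_bound (C := 1) (by have := hσ.measurable t; fun_prop) (.of_forall fun ω => by
        rw [Real.norm_eq_abs, Real.abs_exp, Real.exp_le_one_iff]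
        exact neg_nonpos.2 (by positivity))
    rw [← ofReal_integral_eq_lintegral_ofReal hint (.of_forall fun _ => Real.exp_nonneg _),
      hlaplace, mul_right_comm]
  refine ⟨1 / c, by positivity, ext_of_laplaceTransform_eq (l₀ := 1) ?_ fun l hl => ?_⟩
  · rw [hpot 1 le_rfl]
    exact ENNReal.ofReal_ne_top
  · have hl0 : 0 < l := one_pos.trans_le hl
    rw [hpot l hl, laplaceTransform_powerMeasure (by positivity) (by linarith) hl0,
      sub_add_cancel, Real.div_rpow zero_le_one hl0.le, Real.one_rpow]
    congr 1
    field_simp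

end IsStableSubordinator

end Subordinator

section RegenerativeSet

namespace ClosedSubset

lemma measurableSet_inter_nonempty {G : Set ℝ≥0} (hG : IsOpen G) :
    MeasurableSet {F : ClosedSubset | (F.carrier ∩ G).Nonempty} :=
  (TopologicalSpace.isOpen_generateFrom_of_mem (Or.inl ⟨G, hG, rfl⟩)).measurableSet

lemma measurableSet_mem (r : ℝ≥0) : MeasurableSet {F : ClosedSubset | r ∈ F.carrier} := by
  have hmiss : IsOpen {F : ClosedSubset | F.carrier ∩ {r} = ∅} :=
    TopologicalSpace.isOpen_generateFrom_of_mem (Or.inr ⟨{r}, isCompact_singleton, rfl⟩)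
  have hcompl : {F : ClosedSubset | r ∈ F.carrier} = {F | F.carrier ∩ {r} = ∅}ᶜ := by
    ext F
    simp
  exact hcompl ▸ hmiss.measurableSet.compl

lemma measurableSet_prod_inter_nonempty {E : Type*} [TopologicalSpace E]
    [SecondCountableTopology E] [MeasurableSpace E] [OpensMeasurableSpace E]
    {O : Set (E × ℝ≥0)} (hO : IsOpen O) :
    MeasurableSet {p : E × ClosedSubset | (p.2.carrier ∩ {r | (p.1, r) ∈ O}).Nonempty} := by
  let bE := TopologicalSpace.countableBasis E
  let bR := TopologicalSpace.countableBasis ℝ≥0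
  have hbE : TopologicalSpace.IsTopologicalBasis bE := TopologicalSpace.isBasis_countableBasis E
  have hbR : TopologicalSpace.IsTopologicalBasis bR :=
    TopologicalSpace.isBasis_countableBasis ℝ≥0
  have hunion : {p : E × ClosedSubset | (p.2.carrier ∩ {r | (p.1, r) ∈ O}).Nonempty} =
      ⋃ A ∈ bE, ⋃ B ∈ bR, ⋃ _ : A ×ˢ B ⊆ O,
        A ×ˢ {F : ClosedSubset | (F.carrier ∩ B).Nonempty} := by
    ext ⟨v, F⟩
    simp only [mem_ofPred_eq, mem_iUnion, mem_prod, exists_prop]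
    constructor
    · rintro ⟨r, hr, hvr⟩
      obtain ⟨_, ⟨A, hA, B, hB, rfl⟩, hAB, hsub⟩ := (hbE.prod hbR).exists_subset_of_mem_open hvr hO
      exact ⟨A, hA, B, hB, hsub, hAB.1, r, hr, hAB.2⟩
    · rintro ⟨A, -, B, -, hsub, hv, r, hr, hrB⟩
      exact ⟨r, hr, hsub (mk_mem_prod hv hrB)⟩
  rw [hunion]
  exact .biUnion (TopologicalSpace.countable_countableBasis E) fun A hA =>
    .biUnion (TopologicalSpace.countable_countableBasis ℝ≥0) fun B hB => .iUnion fun _ =>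
      (hbE.isOpen hA).measurableSet.prod (measurableSet_inter_nonempty (hbR.isOpen hB))

end ClosedSubset

/-- The pairs `(v, F)` for which the shifted set `v + F` meets `G`: a point `(u, v, F)` contributes
to `η(G)` exactly when `(v, F)` is such a pair. -/
def hittingPairs (G : Set ℝ≥0) : Set (ℝ≥0 × ClosedSubset) :=
  {p | (shiftedSet p.1 p.2 ∩ G).Nonempty}

lemma mem_hittingPairs {G : Set ℝ≥0} {p : ℝ≥0 × ClosedSubset} :
    p ∈ hittingPairs G ↔ (p.2.carrier ∩ {r | p.1 + r ∈ G}).Nonempty := by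
  simp only [hittingPairs, shiftedSet, mem_ofPred_eq, image_inter_nonempty_iff]
  rfl

lemma mem_hittingPairs_singleton {t : ℝ≥0} {p : ℝ≥0 × ClosedSubset} :
    p ∈ hittingPairs {t} ↔ t ∈ shiftedSet p.1 p.2 :=
  inter_singleton_nonempty

lemma hittingPairs_mono {G G' : Set ℝ≥0} (h : G ⊆ G') : hittingPairs G ⊆ hittingPairs G' :=
  fun _ => Nonempty.mono (inter_subset_inter_right _ h)

lemma measurableSet_hittingPairs {G : Set ℝ≥0} (hG : IsOpen G) :
    MeasurableSet (hittingPairs G) := by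
  have hO : IsOpen {q : ℝ≥0 × ℝ≥0 | q.1 + q.2 ∈ G} := hG.preimage continuous_add
  convert ClosedSubset.measurableSet_prod_inter_nonempty hO using 1
  ext p
  exact mem_hittingPairs

lemma IsSubordinator.prod_hittingPairs_mul_le {Ω : Type*} [MeasurableSpace Ω]
    {σ : ℝ≥0 → Ω → ℝ≥0} {P : Measure Ω} [SFinite P] (hσ : IsSubordinator σ P)
    {ν : Measure ClosedSubset}
    (hlaw : HasLaw (fun ω => ClosedSubset.closureRange fun t => σ t ω) ν P)
    (μ : Measure ℝ≥0) [SFinite μ] {G G' : Set ℝ≥0} (hG : IsOpen G) (hG' : MeasurableSet G')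
    {h : ℝ≥0} (hadd : ∀ r ∈ G, ∀ s ≤ h, r + s ∈ G') :
    μ.prod ν (hittingPairs G) * potentialMeasure σ P (Iic h) ≤
      (μ ∗ potentialMeasure σ P) G' := by
  have : SFinite ν := hlaw.map_eq ▸ inferInstance
  have hslice (v : ℝ≥0) : ν (Prod.mk v ⁻¹' hittingPairs G) * potentialMeasure σ P (Iic h) ≤
      potentialMeasure σ P ((v + ·) ⁻¹' G') := by
    have hopen : IsOpen ((v + ·) ⁻¹' G) := hG.preimage (continuous_const_add v)
    have heq : Prod.mk v ⁻¹' hittingPairs G =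
        {F | (F.carrier ∩ (v + ·) ⁻¹' G).Nonempty} := by
      ext F
      exact mem_hittingPairs
    rw [heq, ← hlaw.measure_eq (ClosedSubset.measurableSet_inter_nonempty hopen)]
    simp only [ClosedSubset.closureRange, closure_inter_open_nonempty_iff hopen]
    refine hσ.measure_range_inter_mul_potentialMeasure_le hopen (measurable_const_add v hG')
      fun r hr s hs => ?_
    simpa only [mem_preimage, add_assoc] using hadd _ hr s hs
  calc μ.prod ν (hittingPairs G) * potentialMeasure σ P (Iic h)
      = ∫⁻ v, ν (Prod.mk v ⁻¹' hittingPairs G) * potentialMeasure σ P (Iic h) ∂μ := by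
        have hmeas := measurable_measure_prodMk_left (ν := ν) (measurableSet_hittingPairs hG)
        rw [lintegral_mul_const _ hmeas, Measure.prod_apply (measurableSet_hittingPairs hG)]
    _ ≤ ∫⁻ v, potentialMeasure σ P ((v + ·) ⁻¹' G') ∂μ := lintegral_mono hslice
    _ = (μ ∗ potentialMeasure σ P) G' := by
        rw [Measure.conv, Measure.map_apply measurable_add hG',
          Measure.prod_apply (measurable_add hG')]
        rfl

namespace IsStableRegenerativeLaw

variable {β : ℝ} {ν : Measure ClosedSubset}

lemma isProbabilityMeasure (hν : IsStableRegenerativeLaw β ν) : IsProbabilityMeasure ν := by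
  obtain ⟨_, _, _, _, _, _, hlaw⟩ := hν
  exact hlaw.isProbabilityMeasure_iff.1 inferInstance

lemma measure_zero_mem (hν : IsStableRegenerativeLaw β ν) :
    ν {F : ClosedSubset | 0 ∈ F.carrier} = 1 := by
  obtain ⟨Ω, _, P, σ, _, hσ, hlaw⟩ := hν
  have hzero (ω : Ω) : 0 ∈ (ClosedSubset.closureRange fun t => σ t ω).carrier :=
    subset_closure ⟨0, hσ.zero ω⟩
  rw [← hlaw.measure_eq (ClosedSubset.measurableSet_mem 0)]
  simp [hzero]

lemma prod_hittingPairs_Ioo_zero (hν : IsStableRegenerativeLaw β ν) (μ : Measure ℝ≥0)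
    [SFinite μ] [NullSingletonClass μ] (b : ℝ≥0) :
    μ.prod ν (hittingPairs (Ioo 0 b)) = μ (Ioo 0 b) := by
  have := hν.isProbabilityMeasure
  refine le_antisymm ?_ ?_
  · have hsub : hittingPairs (Ioo 0 b) ⊆ Ico 0 b ×ˢ univ := by
      rintro ⟨v, F⟩ ⟨_, ⟨r, -, rfl⟩, -, hb⟩
      exact ⟨⟨zero_le, le_self_add.trans_lt hb⟩, trivial⟩
    calc μ.prod ν (hittingPairs (Ioo 0 b)) ≤ μ (Ico 0 b) * ν univ :=
          (measure_mono hsub).trans_eq (Measure.prod_prod _ _)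
      _ = μ (Ioo 0 b) := by rw [measure_univ, mul_one, measure_congr Ioo_ae_eq_Ico]
  · have hsub : Ioo 0 b ×ˢ {F : ClosedSubset | 0 ∈ F.carrier} ⊆ hittingPairs (Ioo 0 b) := by
      rintro ⟨v, F⟩ ⟨hv, hF⟩
      exact ⟨v, ⟨0, hF, add_zero v⟩, hv⟩
    calc μ (Ioo 0 b) = μ.prod ν (Ioo 0 b ×ˢ {F : ClosedSubset | 0 ∈ F.carrier}) := by
          rw [Measure.prod_prod, hν.measure_zero_mem, mul_one]
      _ ≤ μ.prod ν (hittingPairs (Ioo 0 b)) := measure_mono hsub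

/- The exponent `-β` of the shift `v` is the one whose convolution with the potential measure is a
multiple of Lebesgue measure. After hitting an interval of length `h`, the set `v + F` carries
potential mass of order `h ^ β` within distance `h`, out of a total mass of order `h`. -/
lemma exists_prod_hittingPairs_Ioo_le (hν : IsStableRegenerativeLaw β ν)
    (hβ : β ∈ Ioo (0 : ℝ) 1) :
    ∃ C : ℝ, 0 ≤ C ∧ ∀ a h : ℝ≥0, 0 < h →
      (powerMeasure (1 - β) (-β)).prod ν (hittingPairs (Ioo a (a + h))) ≤
        ENNReal.ofReal (C * (h : ℝ) ^ (1 - β)) := by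
  obtain ⟨Ω, _, P, σ, _, hσ, hlaw⟩ := hν
  obtain ⟨c, hc, hpot⟩ := hσ.exists_potentialMeasure_eq hβ.1
  have hβ0 : 0 < β := hβ.1
  have hβ1 : 0 < 1 - β := sub_pos.2 hβ.2
  have := Real.Gamma_pos_of_pos hβ0
  have := Real.Gamma_pos_of_pos hβ1
  let d : ℝ := c / Real.Gamma β
  let K : ℝ := (1 - β) * d * (Real.Gamma (1 - β) * Real.Gamma β)
  have hd : 0 < d := by positivity
  have hK : 0 < K := by positivity
  refine ⟨2 * K * β / d, by positivity, fun a h hh => ?_⟩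
  have hh' : (0 : ℝ) < h := hh
  have hvisit : potentialMeasure σ P (Iic h) = ENNReal.ofReal (d * ((h : ℝ) ^ β / β)) := by
    rw [hpot, powerMeasure_Iic hd.le (by linarith), sub_add_cancel]
  have htotal : (powerMeasure (1 - β) (-β) ∗ potentialMeasure σ P) (Ioo a (a + 2 * h)) =
      ENNReal.ofReal (2 * K * h) := by
    rw [hpot, powerMeasure_neg_conv_powerMeasure_sub_one hβ1.le hd.le hβ,
      powerMeasure_zero_exponent_Ioo hK.le le_self_add]
    congr 1
    push_cast
    ring
  have hmul := hσ.isSubordinator.prod_hittingPairs_mul_le hlaw (powerMeasure (1 - β) (-β))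
    (isOpen_Ioo (a := a) (b := a + h)) (measurableSet_Ioo (a := a) (b := a + 2 * h))
    fun r hr s (hs : s ≤ h) => ⟨hr.1.trans_le le_self_add, by
      rw [two_mul, ← add_assoc]
      exact add_lt_add_of_lt_of_le hr.2 hs⟩
  have hpos : 0 < d * ((h : ℝ) ^ β / β) := by positivity
  rw [htotal, hvisit, ← ENNReal.le_div_iff_mul_le (by simp [hpos]) (by simp),
    ← ENNReal.ofReal_div_of_pos hpos] at hmul
  refine hmul.trans_eq (congrArg ENNReal.ofReal ?_)
  rw [Real.rpow_sub hh', Real.rpow_one]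
  field_simp

end IsStableRegenerativeLaw

end RegenerativeSet

section SupMeasure

lemma lt_indicator_shiftedSet_iff {p : ℝ≥0 × ℝ≥0 × ClosedSubset} {t y : ℝ≥0} :
    (y : ℝ≥0∞) < (shiftedSet p.2.1 p.2.2).indicator (fun _ => (p.1 : ℝ≥0∞)) t ↔
      p ∈ Ioi y ×ˢ hittingPairs {t} := by
  rw [mem_prod, mem_hittingPairs_singleton]
  by_cases ht : t ∈ shiftedSet p.2.1 p.2.2 <;> simp [ht]

variable {Ω : Type*} {X : ℕ → Ω → ℝ≥0 × ℝ≥0 × ClosedSubset} {ω : Ω}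

lemma etaFun_le_add_mul {t y₁ y₂ : ℝ≥0} {m : ℕ}
    (h₁ : pointCount X (Ioi y₁ ×ˢ hittingPairs {t}) ω < 1)
    (h₂ : pointCount X (Ioi y₂ ×ˢ hittingPairs {t}) ω < 2)
    (hm : pointCount X (Ioi 0 ×ˢ hittingPairs {t}) ω ≤ m) :
    etaFun (fun j => X j ω) t ≤ y₁ + m * y₂ := by
  refine tsum_le_add_mul_of_subsingleton (fun j => not_lt.1 fun hj => ?_) ?_ ?_
  · have hempty := encard_eq_zero.1 (Order.lt_one_iff.1 h₁)
    exact hempty.subset (lt_indicator_shiftedSet_iff.1 hj)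
  · simp only [lt_indicator_shiftedSet_iff]
    exact encard_le_one_iff_subsingleton.1
      (Order.le_of_lt_add_one (h₂.trans_eq one_add_one_eq_two.symm))
  · exact hm.trans' (encard_le_encard fun j hj =>
      lt_indicator_shiftedSet_iff.1 (pos_iff_ne_zero.2 hj))

lemma etaSup_le_add_mul {G : Set ℝ≥0} {y₁ y₂ : ℝ≥0} {m : ℕ}
    (h₁ : pointCount X (Ioi y₁ ×ˢ hittingPairs G) ω < 1)
    (h₂ : pointCount X (Ioi y₂ ×ˢ hittingPairs G) ω < 2)
    (hm : ∀ t ∈ G, pointCount X (Ioi 0 ×ˢ hittingPairs {t}) ω ≤ m) :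
    etaSup (fun j => X j ω) G ≤ y₁ + m * y₂ := by
  refine iSup₂_le fun t ht => ?_
  have hle (y : ℝ≥0) : pointCount X (Ioi y ×ˢ hittingPairs {t}) ω ≤
      pointCount X (Ioi y ×ˢ hittingPairs G) ω :=
    pointCount_mono (prod_mono_right (hittingPairs_mono (singleton_subset_iff.2 ht))) ω
  exact etaFun_le_add_mul ((hle y₁).trans_lt h₁) ((hle y₂).trans_lt h₂) (hm t ht)

lemma lt_etaSup_of_one_le_pointCount {G : Set ℝ≥0} {x : ℝ≥0}
    (h : 1 ≤ pointCount X (Ioi x ×ˢ hittingPairs G) ω) : x < etaSup (fun j => X j ω) G := by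
  obtain ⟨j, hx, t, ht, htG⟩ := one_le_encard_iff_nonempty.1 h
  calc (x : ℝ≥0∞) < (shiftedSet (X j ω).2.1 (X j ω).2.2).indicator
        (fun _ => ((X j ω).1 : ℝ≥0∞)) t :=
        lt_indicator_shiftedSet_iff.2 ⟨hx, mem_hittingPairs_singleton.2 ht⟩
    _ ≤ etaFun (fun j => X j ω) t := ENNReal.le_tsum j
    _ ≤ etaSup (fun j => X j ω) G :=
        le_iSup₂ (f := fun t (_ : t ∈ G) => etaFun (fun j => X j ω) t) t htG

end SupMeasure

section TailBounds

variable {α β : ℝ} {ν : Measure ClosedSubset}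

lemma meanMeasure_Ioi_prod (hα : 0 < α) (hν : IsStableRegenerativeLaw β ν) {x : ℝ≥0} (hx : 0 < x)
    (S : Set (ℝ≥0 × ClosedSubset)) :
    meanMeasure α β ν (Ioi x ×ˢ S) =
      ENNReal.ofReal ((x : ℝ) ^ (-α)) * (powerMeasure (1 - β) (-β)).prod ν S := by
  have := hν.isProbabilityMeasure
  rw [meanMeasure_eq_prod, Measure.prod_prod, powerMeasure_Ioi hα.le (by linarith) hx,
    show -(1 + α) + 1 = -α by ring]
  congr 2
  field_simp

lemma meanMeasure_Ioi_prod_hittingPairs (hα : 0 < α) (hβ : β < 1)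
    (hν : IsStableRegenerativeLaw β ν) {x : ℝ≥0} (hx : 0 < x) :
    meanMeasure α β ν (Ioi x ×ˢ hittingPairs (Ioo 0 1)) = ENNReal.ofReal ((x : ℝ) ^ (-α)) := by
  have hβ' : 0 < 1 - β := sub_pos.2 hβ
  rw [meanMeasure_Ioi_prod hα hν hx, hν.prod_hittingPairs_Ioo_zero,
    powerMeasure_Ioo_zero hβ'.le (by linarith), neg_add_eq_sub, NNReal.coe_one, Real.one_rpow,
    mul_one_div_cancel hβ'.ne', ENNReal.ofReal_one, mul_one]

variable {Ω : Type*} [MeasurableSpace Ω] {P : Measure Ω} {X : ℕ → Ω → ℝ≥0 × ℝ≥0 × ClosedSubset}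

lemma measure_exists_le_pointCount_Ioi_prod_eq_zero (hα : 0 < α) (hβ : β ∈ Ioo (0 : ℝ) 1)
    (hν : IsStableRegenerativeLaw β ν) (hX : IsPoissonEnumeration X (meanMeasure α β ν) P)
    {m : ℕ} (hm : 1 < (1 - β) * m) {ε : ℝ≥0} (hε : 0 < ε) :
    P {ω | ∃ t ∈ Ioo (0 : ℝ≥0) 1, m ≤ pointCount X (Ioi ε ×ˢ hittingPairs {t}) ω} = 0 := by
  obtain ⟨C, hC, hhit⟩ := hν.exists_prod_hittingPairs_Ioo_le hβ
  refine hX.measure_exists_mem_Ioo_le_pointCount_eq_zero (C := (ε : ℝ) ^ (-α) * C) (by positivity)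
    (fun a h hh => ⟨Ioi ε ×ˢ hittingPairs (Ioo a (a + h)),
      measurableSet_Ioi.prod (measurableSet_hittingPairs isOpen_Ioo), fun t ht =>
        prod_mono_right (hittingPairs_mono (singleton_subset_iff.2 ht)), ?_⟩) hm
  rw [meanMeasure_Ioi_prod hα hν hε, mul_assoc, ENNReal.ofReal_mul (by positivity)]
  gcongr
  exact hhit a h hh

lemma ae_forall_pointCount_Ioi_zero_prod_lt (hα : 0 < α) (hβ : β ∈ Ioo (0 : ℝ) 1)
    (hν : IsStableRegenerativeLaw β ν) (hX : IsPoissonEnumeration X (meanMeasure α β ν) P)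
    {m : ℕ} (hm : 1 < (1 - β) * m) :
    ∀ᵐ ω ∂P, ∀ t ∈ Ioo (0 : ℝ≥0) 1, pointCount X (Ioi 0 ×ˢ hittingPairs {t}) ω < m := by
  have hlevels : ∀ᵐ ω ∂P, ∀ n : ℕ, ¬ ∃ t ∈ Ioo (0 : ℝ≥0) 1,
      m ≤ pointCount X (Ioi (1 / ((n : ℝ≥0) + 1)) ×ˢ hittingPairs {t}) ω :=
    ae_all_iff.2 fun n => measure_eq_zero_iff_ae_notMem.1
      (measure_exists_le_pointCount_Ioi_prod_eq_zero hα hβ hν hX hm (by positivity))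
  filter_upwards [hlevels] with ω hω t ht
  by_contra! hle
  obtain ⟨J, hJ, hcard⟩ := exists_subset_encard_eq hle
  have hmarks : ∀ᶠ n : ℕ in atTop, ∀ j ∈ J, 1 / ((n : ℝ≥0) + 1) < (X j ω).1 :=
    (eventually_all_finite (finite_of_encard_eq_coe hcard)).2 fun j hj =>
      (tendsto_one_div_add_atTop_nhds_zero_nat (𝕜 := ℝ≥0)).eventually_lt_const (hJ hj).1
  obtain ⟨n, hn⟩ := hmarks.exists
  exact hω n ⟨t, ht, hcard.symm.trans_le (encard_le_encard fun j hj => ⟨hn j hj, (hJ hj).2⟩)⟩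

/- Off a null set fewer than `m` shifted sets overlap anywhere in `(0, 1)`. The sup-measure can
then exceed `y₁ + m * y₂` only if some mark exceeds `y₁` or two marks exceed `y₂`. -/
lemma measureReal_lt_etaSup_le (hα : 0 < α) (hβ : β ∈ Ioo (0 : ℝ) 1)
    (hν : IsStableRegenerativeLaw β ν) (hX : IsPoissonEnumeration X (meanMeasure α β ν) P)
    {m : ℕ} (hm : 1 < (1 - β) * m) {y₁ y₂ : ℝ≥0} (h₁ : 0 < y₁) (h₂ : 0 < y₂) :
    P.real {ω | ((y₁ + m * y₂ : ℝ≥0) : ℝ≥0∞) < etaSup (fun j => X j ω) (Ioo 0 1)} ≤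
      (y₁ : ℝ) ^ (-α) + ((y₂ : ℝ) ^ (-α)) ^ 2 := by
  let B : ℝ≥0 → Set (ℝ≥0 × ℝ≥0 × ClosedSubset) := fun y => Ioi y ×ˢ hittingPairs (Ioo 0 1)
  have hB (y : ℝ≥0) : MeasurableSet (B y) :=
    measurableSet_Ioi.prod (measurableSet_hittingPairs isOpen_Ioo)
  have hcount {y : ℝ≥0} (hy : 0 < y) (n : ℕ) :
      P {ω | n ≤ pointCount X (B y) ω} ≤ ENNReal.ofReal ((y : ℝ) ^ (-α)) ^ n := by
    rw [← meanMeasure_Ioi_prod_hittingPairs hα hβ.2 hν hy]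
    exact hX.measure_le_pointCount_le (hB y) n
  have hsub : {ω | ((y₁ + m * y₂ : ℝ≥0) : ℝ≥0∞) < etaSup (fun j => X j ω) (Ioo 0 1)} ≤ᵐ[P]
      ({ω | (1 : ℕ) ≤ pointCount X (B y₁) ω} ∪ {ω | (2 : ℕ) ≤ pointCount X (B y₂) ω} :
        Set Ω) := by
    filter_upwards [ae_forall_pointCount_Ioi_zero_prod_lt hα hβ hν hX hm] with ω hoverlap hω
    by_contra hcon
    obtain ⟨hone, htwo⟩ := not_or.1 hcon
    refine not_le.2 hω ?_
    push_cast
    exact etaSup_le_add_mul (not_le.1 hone) (not_le.1 htwo) fun t ht => (hoverlap t ht).le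
  refine ENNReal.toReal_le_of_le_ofReal (by positivity) ?_
  rw [ENNReal.ofReal_add (by positivity) (by positivity), ENNReal.ofReal_pow (by positivity)]
  calc P {ω | ((y₁ + m * y₂ : ℝ≥0) : ℝ≥0∞) < etaSup (fun j => X j ω) (Ioo 0 1)}
      ≤ P {ω | (1 : ℕ) ≤ pointCount X (B y₁) ω} + P {ω | (2 : ℕ) ≤ pointCount X (B y₂) ω} :=
        (measure_mono_ae hsub).trans (measure_union_le _ _)
    _ ≤ ENNReal.ofReal ((y₁ : ℝ) ^ (-α)) + ENNReal.ofReal ((y₂ : ℝ) ^ (-α)) ^ 2 :=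
        add_le_add ((hcount h₁ 1).trans_eq (pow_one _)) (hcount h₂ 2)

lemma le_measureReal_lt_etaSup [IsFiniteMeasure P] (hα : 0 < α) (hβ : β < 1)
    (hν : IsStableRegenerativeLaw β ν) (hX : IsPoissonEnumeration X (meanMeasure α β ν) P)
    {x : ℝ≥0} (hx : 0 < x) :
    1 - Real.exp (-((x : ℝ) ^ (-α))) ≤
      P.real {ω | (x : ℝ≥0∞) < etaSup (fun j => X j ω) (Ioo 0 1)} := by
  have hmean := meanMeasure_Ioi_prod_hittingPairs hα hβ hν hx
  have hone := hX.measureReal_one_le_pointCount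
    (measurableSet_Ioi.prod (measurableSet_hittingPairs isOpen_Ioo)) (hmean ▸ ENNReal.ofReal_ne_top)
  rw [hmean, ENNReal.toReal_ofReal (by positivity)] at hone
  exact hone.symm.trans_le (measureReal_mono fun ω => lt_etaSup_of_one_le_pointCount)

end TailBounds

section Asymptotics

variable {α : ℝ}

lemma tendsto_rpow_mul_one_sub_exp_neg_rpow (hα : 0 < α) :
    Tendsto (fun x : ℝ => x ^ α * (1 - Real.exp (-x ^ (-α)))) atTop (𝓝 1) := by
  have hslope : Tendsto (fun h : ℝ => h⁻¹ * (Real.exp h - 1)) (𝓝[≠] 0) (𝓝 1) := by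
    simpa using (Real.hasDerivAt_exp 0).tendsto_slope_zero
  have hlim : Tendsto (fun x : ℝ => -x ^ (-α)) atTop (𝓝[≠] 0) := by
    refine tendsto_nhdsWithin_iff.2 ⟨by simpa using (tendsto_rpow_neg_atTop hα).neg, ?_⟩
    filter_upwards [eventually_gt_atTop 0] with x hx
    exact neg_ne_zero.2 (Real.rpow_pos_of_pos hx _).ne'
  refine (hslope.comp hlim).congr' ?_
  filter_upwards [eventually_gt_atTop 0] with x hx
  rw [Function.comp_apply, Real.rpow_neg hx.le, inv_neg, inv_inv]
  ring

lemma self_sub_mul_rpow_eq {x : ℝ} (hx : 0 < x) (m s : ℝ) :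
    x - m * x ^ s = x * (1 - m * x ^ (s - 1)) := by
  rw [Real.rpow_sub_one hx.ne']
  field_simp

lemma tendsto_one_sub_mul_rpow_sub_one (m : ℝ) {s : ℝ} (hs : s < 1) :
    Tendsto (fun x : ℝ => 1 - m * x ^ (s - 1)) atTop (𝓝 1) := by
  simpa using ((tendsto_rpow_neg_atTop (sub_pos.2 hs)).const_mul m).const_sub 1

lemma tendsto_rpow_mul_sub_rpow_neg_add (hα : 0 < α) (m : ℝ) {s : ℝ} (hs : s ∈ Ioo (1 / 2) 1) :
    Tendsto (fun x : ℝ => x ^ α * ((x - m * x ^ s) ^ (-α) + ((x ^ s) ^ (-α)) ^ 2)) atTop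
      (𝓝 1) := by
  have hratio := tendsto_one_sub_mul_rpow_sub_one m hs.2
  have hmain : Tendsto (fun x : ℝ => (1 - m * x ^ (s - 1)) ^ (-α)) atTop (𝓝 1) := by
    simpa using hratio.rpow_const (p := -α) (.inl one_ne_zero)
  have hexponent : 0 < α * (2 * s - 1) := mul_pos hα (by linarith [hs.1])
  have hsum := hmain.add (tendsto_rpow_neg_atTop hexponent)
  rw [add_zero] at hsum
  refine hsum.congr' ?_
  filter_upwards [eventually_gt_atTop 0, hratio.eventually_const_lt zero_lt_one] with x hx hpos
  have hsquare : x ^ α * ((x ^ s) ^ (-α)) ^ 2 = x ^ (-(α * (2 * s - 1))) := by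
    rw [← Real.rpow_natCast, ← Real.rpow_mul hx.le, ← Real.rpow_mul hx.le, ← Real.rpow_add hx]
    push_cast
    ring_nf
  rw [mul_add, hsquare, self_sub_mul_rpow_eq hx, Real.mul_rpow hx.le hpos.le, ← mul_assoc,
    ← Real.rpow_add hx, add_neg_cancel, Real.rpow_zero, one_mul]

/- For the upper bound split `x = y₁ + m * y₂` with `y₂ = x ^ (3 / 4)`: then `m * y₂` is `o(x)`,
while `y₂ ^ (-2 * α)` is `o(x ^ (-α))`. -/
lemma tendsto_rpow_mul_of_le_of_le {f : ℝ → ℝ} {m : ℝ} (hα : 0 < α)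
    (hlower : ∀ x, 0 < x → 1 - Real.exp (-x ^ (-α)) ≤ f x)
    (hupper : ∀ y₁ y₂, 0 < y₁ → 0 < y₂ → f (y₁ + m * y₂) ≤ y₁ ^ (-α) + (y₂ ^ (-α)) ^ 2) :
    Tendsto (fun x => x ^ α * f x) atTop (𝓝 1) := by
  have hs : (3 / 4 : ℝ) ∈ Ioo (1 / 2) 1 := by constructor <;> norm_num
  refine tendsto_of_tendsto_of_tendsto_of_le_of_le' (tendsto_rpow_mul_one_sub_exp_neg_rpow hα)
    (tendsto_rpow_mul_sub_rpow_neg_add hα m hs) ?_ ?_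
  · filter_upwards [eventually_gt_atTop 0] with x hx
    gcongr
    exact hlower x hx
  · filter_upwards [eventually_gt_atTop 0,
      (tendsto_one_sub_mul_rpow_sub_one m hs.2).eventually_const_lt zero_lt_one] with x hx hratio
    have hpos : 0 < x - m * x ^ (3 / 4 : ℝ) :=
      (mul_pos hx hratio).trans_eq (self_sub_mul_rpow_eq hx m _).symm
    gcongr
    simpa only [sub_add_cancel] using hupper _ _ hpos (Real.rpow_pos_of_pos hx (3 / 4))

lemma tendsto_div_of_tendsto_rpow_mul {f : ℝ → ℝ} {a c : ℝ} (ha : a ≠ 0)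
    (hf : Tendsto (fun x : ℝ => x ^ α * f x) atTop (𝓝 a)) (hc : 0 < c) :
    Tendsto (fun x => f (c * x) / f x) atTop (𝓝 (c ^ (-α))) := by
  have hscaled : Tendsto (fun x => (c * x) ^ α * f (c * x)) atTop (𝓝 a) :=
    hf.comp (tendsto_id.const_mul_atTop hc)
  have hratio := (hscaled.div hf ha).const_mul (c ^ (-α))
  rw [div_self ha, mul_one] at hratio
  refine hratio.congr' ?_
  filter_upwards [eventually_gt_atTop 0] with x hx
  have := Real.rpow_pos_of_pos hx α
  have := Real.rpow_pos_of_pos hc α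
  rw [Pi.div_apply, Real.mul_rpow hc.le hx.le, Real.rpow_neg hc.le]
  field_simp

end Asymptotics

theorem mainTheorem3 (α β : ℝ) (hα : 0 < α) (hβ : β ∈ Set.Ioo (0 : ℝ) 1)
    (ν : Measure ClosedSubset) (hν : IsStableRegenerativeLaw β ν)
    {Ω : Type*} [MeasurableSpace Ω] (P : Measure Ω) [IsProbabilityMeasure P]
    (X : ℕ → Ω → ℝ≥0 × ℝ≥0 × ClosedSubset)
    (hX : IsPoissonEnumeration X (meanMeasure α β ν) P) :
    Tendsto (fun x : ℝ =>
        x ^ α * P.real {ω | ENNReal.ofReal x < etaSup (fun j => X j ω) (Set.Ioo 0 1)})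
      atTop (𝓝 1) ∧
    ∀ c : ℝ, 0 < c →
      Tendsto (fun x : ℝ =>
          P.real {ω | ENNReal.ofReal (c * x) < etaSup (fun j => X j ω) (Set.Ioo 0 1)} /
            P.real {ω | ENNReal.ofReal x < etaSup (fun j => X j ω) (Set.Ioo 0 1)})
        atTop (𝓝 (c ^ (-α))) := by
  obtain ⟨m, hm⟩ := exists_nat_gt (1 / (1 - β))
  rw [div_lt_iff₀' (sub_pos.2 hβ.2)] at hm
  have htail : Tendsto (fun x : ℝ =>
      x ^ α * P.real {ω | ENNReal.ofReal x < etaSup (fun j => X j ω) (Ioo 0 1)}) atTop (𝓝 1) := by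
    refine tendsto_rpow_mul_of_le_of_le (m := m) hα (fun x hx => ?_) fun y₁ y₂ h₁ h₂ => ?_
    · lift x to ℝ≥0 using hx.le
      simpa only [ENNReal.ofReal_coe_nnreal] using le_measureReal_lt_etaSup hα hβ.2 hν hX hx
    · lift y₁ to ℝ≥0 using h₁.le
      lift y₂ to ℝ≥0 using h₂.le
      simpa only [← ENNReal.ofReal_coe_nnreal, NNReal.coe_add, NNReal.coe_mul, NNReal.coe_natCast]
        using measureReal_lt_etaSup_le hα hβ hν hX hm h₁ h₂
  exact ⟨htail, fun c hc => tendsto_div_of_tendsto_rpow_mul one_ne_zero htail hc⟩
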